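/- Let a group $H$ act on a set $X$ and let $Z$ be a non-trivial group. Let $Z^{(X)}$ be the group of finitely supported functions $a:X\to Z$ (i.e. $a(x)\neq 1$ for only finitely many $x$), on which $H$ acts by the Bernoulli shift $(\sigma_g a)(x)=a(g^{-1}x)$, and let $G=Z\wr_X H=Z^{(X)}\rtimes_\sigma H$ be the restricted wreath product, with $H$ viewed as a subgroup of $G$. An action of a group $\Gamma$ on a set $Y$ is called amenable if there is a $\Gamma$-invariant state on $\ell^\infty(Y)$. A subgroup $K$ of a group $L$ is called inner amenable relative to $L$ if $K\neq L$ and the action of $K$ on $L\smallsetminus K$ by conjugation is amenable; it is non-trivially so if, moreover, there is no $g\in L\smallsetminus K$ for which $\{kgk^{-1}:k\in K\}$ is finite. Then: 1. The action of $H$ on $Z^{(X)}\smallsetminus\{1\}$ is amenable if and only if the action of $H$ on $X$ is amenable. 2. If the action of $H$ on $X$ is amenable, then $H$ is inner amenable relative to $G$. 3. Suppose that $X$ is infinite. Then the condition $(\star)$: "$\{hgh^{-1}:h\in H\}$ is infinite for every $g\in G\smallsetminus H$" holds if and only if all orbits of $H$ on $X$ are infinite. 4. If the action of $H$ on $X$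 is amenable and all its orbits are infinite, then $H$ is non-trivially inner amenable relative to $G$. -/

import Mathlib

open scoped ENNReal ComplexOrder

namespace RelInner

/-! ### Amenable actions on sets -/

section Amenable

variable {H X : Type*} [Group H] [MulAction H X]

/-- The translate `g · a` of a bounded function: `(g · a) x = a (g⁻¹ • x)`. -/
def translate (g : H) (a : lp (fun _ : X => ℂ) ∞) : lp (fun _ : X => ℂ) ∞ :=
  ⟨fun x => a (g⁻¹ • x), by
    obtain ⟨C, hC⟩ := memℓp_infty_iff.1 a.2
    refine memℓp_infty_iff.2 ⟨C, ?_⟩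
    rintro _ ⟨x, rfl⟩
    exact hC ⟨g⁻¹ • x, rfl⟩⟩

/-- A state on the algebra of bounded complex functions on `X`: a linear functional which is
positive (nonnegative on functions with values in `[0, ∞)`) and unital. -/
structure IsState (φ : lp (fun _ : X => ℂ) ∞ →ₗ[ℂ] ℂ) : Prop where
  pos : ∀ a : lp (fun _ : X => ℂ) ∞, (∀ x, 0 ≤ a x) → 0 ≤ φ a
  unital : φ 1 = 1

variable (H X) in
/-- The action of `H` on `X` is amenable: there is an `H`-invariant state on bounded functions. -/
def IsAmenableAction : Prop :=
  ∃ φ : lp (fun _ : X => ℂ) ∞ →ₗ[ℂ] ℂ, IsState φ ∧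
    ∀ (g : H) (a : lp (fun _ : X => ℂ) ∞), φ (translate g a) = φ a

end Amenable

/-! ### Relative inner amenability of a subgroup -/

section Relative

variable {G : Type*} [Group G] (K : Subgroup G)

/-- The set-theoretic complement of a subgroup. -/
def Complement : Type _ := {g : G // g ∉ K}

/-- The subgroup acts on its complement by conjugation. -/
instance : MulAction K (Complement K) where
  smul h g := ⟨(h : G) * g.1 * (h : G)⁻¹, fun hm => g.2 <| by
    have := K.mul_mem (K.mul_mem (K.inv_mem h.2) hm) h.2
    simpa [mul_assoc] using this⟩
  one_smul g := Subtype.ext (show ((1 : K) : G) * g.1 * ((1 : K) : G)⁻¹ = g.1 by simp)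
  mul_smul h k g := Subtype.ext
    (show ((h * k : K) : G) * g.1 * ((h * k : K) : G)⁻¹
      = (h : G) * ((k : G) * g.1 * (k : G)⁻¹) * (h : G)⁻¹ by simp [mul_assoc])

/-- `K` is inner amenable relative to the ambient group. -/
def IsInnerAmenableRel : Prop :=
  K ≠ ⊤ ∧ IsAmenableAction K (Complement K)

/-- The set of conjugates of `g` by elements of `K`. -/
def conjOrbit (g : G) : Set G := {y | ∃ h ∈ K, y = h * g * h⁻¹}

/-- Condition (⋆): the `K`-conjugacy orbit of every `g ∉ K` is infinite. -/
def ConditionStar : Prop := ∀ g : G, g ∉ K → (conjOrbit K g).Infinite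

/-- `K` is trivially inner amenable relative to the ambient group:
some `g ∉ K` has a finite `K`-conjugacy orbit. -/
def IsTriviallyInnerAmenableRel : Prop := ∃ g : G, g ∉ K ∧ (conjOrbit K g).Finite

/-- `K` is inner amenable relative to the ambient group, but not trivially so. -/
def IsNontriviallyInnerAmenableRel : Prop :=
  IsInnerAmenableRel K ∧ ¬ IsTriviallyInnerAmenableRel K

end Relative

/-! ### Finitely supported functions, the Bernoulli action and the restricted wreath product -/

section Wreath

/-- The finitely supported functions `X → Z`, as a subgroup of the full power. -/
def finSuppSubgroup (X Z : Type*) [Group Z] : Subgroup (X → Z) where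
  carrier := {a | {x | a x ≠ 1}.Finite}
  one_mem' := by simp
  mul_mem' {a b} ha hb := by
    refine (Set.Finite.union ha hb).subset fun x hx => ?_
    by_contra hn
    simp only [Set.mem_union, Set.mem_ofPred_eq, not_or, not_not] at hn
    exact hx (by simp [hn.1, hn.2])
  inv_mem' {a} ha := by simpa using ha

/-- The group `Z^{(X)}` of finitely supported functions `X → Z`. -/
def RestrictedPower (X Z : Type*) [Group Z] : Type _ := finSuppSubgroup X Z

instance (X Z : Type*) [Group Z] : Group (RestrictedPower X Z) :=
  inferInstanceAs (Group (finSuppSubgroup X Z))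

/-- The Bernoulli action `(g • a) x = a (g⁻¹ • x)`, by group automorphisms. -/
instance (H X Z : Type*) [Group H] [MulAction H X] [Group Z] :
    MulDistribMulAction H (RestrictedPower X Z) where
  smul g a := ⟨fun x => a.1 (g⁻¹ • x), by
    have h : {x | a.1 x ≠ 1}.Finite := a.2
    exact h.preimage (MulAction.injective g⁻¹).injOn⟩
  one_smul a := Subtype.ext (funext fun x =>
    show a.1 ((1 : H)⁻¹ • x) = a.1 x by simp)
  mul_smul g h a := Subtype.ext (funext fun x =>
    show a.1 ((g * h)⁻¹ • x) = a.1 (h⁻¹ • g⁻¹ • x) by simp [mul_smul])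
  smul_mul _ _ _ := rfl
  smul_one _ := rfl

/-- The set `A ∖ {1}` of nontrivial elements of a group. -/
def NontrivialElements (A : Type*) [Group A] : Type _ := {a : A // a ≠ 1}

/-- An action by automorphisms restricts to the nontrivial elements. -/
instance (H A : Type*) [Group H] [Group A] [MulDistribMulAction H A] :
    MulAction H (NontrivialElements A) where
  smul g a := ⟨g • a.1, fun h => a.2 <| by
    simpa using smul_eq_iff_eq_inv_smul g |>.1 h⟩
  one_smul a := Subtype.ext (one_smul H a.1)
  mul_smul g h a := Subtype.ext (mul_smul g h a.1)

/-- The restricted wreath product `Z ≀_X H`: the semidirect product of `Z^{(X)}` by `H`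
for the Bernoulli action. -/
abbrev RestrictedWreath (Z X H : Type*) [Group Z] [Group H] [MulAction H X] : Type _ :=
  RestrictedPower X Z ⋊[MulDistribMulAction.toMulAut H (RestrictedPower X Z)] H

/-- The canonical copy of `H` in `Z ≀_X H`. -/
def topGroup (Z X H : Type*) [Group Z] [Group H] [MulAction H X] :
    Subgroup (RestrictedWreath Z X H) :=
  (SemidirectProduct.inr : H →* RestrictedWreath Z X H).range

end Wreath

end RelInner

open RelInner

/-! Invariant states are transported by averaging. If each point of `X` is assigned a nonempty
finite subset of `Y`, equivariantly, then averaging over these subsets is a positive unital map from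
bounded functions on `Y` to those on `X`, and an invariant state on `X` pulls back along it
(`IsAmenableAction.of_finsets`). Supports assign finite subsets of `X` to nontrivial elements of the
restricted power. In the other direction, point masses of a fixed `z ≠ 1` map `X` equivariantly to
those elements, and into the complement of `H` in the wreath product. The orbit criterion uses the
same two devices: point masses turn finite orbits into finite conjugacy orbits, supports do the
reverse. -/

namespace RelInner

/-! ### Transport of invariant states -/

section Transport

variable {H X K Y : Type*} [Group H] [MulAction H X] [Group K] [MulAction K Y]

/-- A unital positive linear map intertwining translations pulls invariant states back. -/
theorem IsAmenableAction.of_positive_map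
    (T : lp (fun _ : Y => ℂ) ∞ →ₗ[ℂ] lp (fun _ : X => ℂ) ∞)
    (hpos : ∀ a, (∀ y, 0 ≤ a y) → ∀ x, 0 ≤ T a x) (hone : T 1 = 1)
    (hT : ∀ k : K, ∃ h : H, ∀ a, T (translate k a) = translate h (T a))
    (hX : IsAmenableAction H X) : IsAmenableAction K Y := by
  obtain ⟨φ, hφ, hinv⟩ := hX
  refine ⟨φ ∘ₗ T, ⟨fun a ha => hφ.pos _ (hpos a ha), ?_⟩, fun k a => ?_⟩
  · rw [LinearMap.comp_apply, hone, hφ.unital]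
  · obtain ⟨h, hh⟩ := hT k
    rw [LinearMap.comp_apply, LinearMap.comp_apply, hh, hinv]

/-- The average of a function over a finite set is bounded by any bound of the function. -/
theorem norm_inv_card_mul_sum_le (s : Finset Y) (f : Y → ℂ) {C : ℝ} (hC0 : 0 ≤ C)
    (hC : ∀ y, ‖f y‖ ≤ C) : ‖(s.card : ℂ)⁻¹ * ∑ y ∈ s, f y‖ ≤ C := by
  rcases s.eq_empty_or_nonempty with rfl | hs
  · simpa using hC0
  have hpos : (0 : ℝ) < s.card := by exact_mod_cast hs.card_pos
  have h : ‖∑ y ∈ s, f y‖ ≤ s.card * C := by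
    simpa using norm_sum_le_of_le s fun y _ => hC y
  rw [norm_mul, norm_inv, Complex.norm_natCast, inv_mul_le_iff₀ hpos]
  exact h

/-- Averaging a bounded function on `Y` over finite sets indexed by `X`. -/
noncomputable def averageMap (s : X → Finset Y) :
    lp (fun _ : Y => ℂ) ∞ →ₗ[ℂ] lp (fun _ : X => ℂ) ∞ where
  toFun a := ⟨fun x => ((s x).card : ℂ)⁻¹ * ∑ y ∈ s x, a y, memℓp_infty_iff.2 ⟨‖a‖, by
    rintro _ ⟨x, rfl⟩
    exact norm_inv_card_mul_sum_le _ _ (norm_nonneg a)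
      (lp.norm_apply_le_norm ENNReal.top_ne_zero a)⟩⟩
  map_add' a b := by
    ext x
    change _ * ∑ y ∈ s x, (a y + b y) = _ * ∑ y ∈ s x, a y + _ * ∑ y ∈ s x, b y
    rw [Finset.sum_add_distrib, mul_add]
  map_smul' c a := by
    ext x
    change _ * ∑ y ∈ s x, c * a y = c * (_ * ∑ y ∈ s x, a y)
    rw [← Finset.mul_sum, mul_left_comm]

theorem averageMap_apply (s : X → Finset Y) (a : lp (fun _ : Y => ℂ) ∞) (x : X) :
    averageMap s a x = ((s x).card : ℂ)⁻¹ * ∑ y ∈ s x, a y := rfl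

/-- Amenability transfers along an equivariant family of nonempty finite subsets. -/
theorem IsAmenableAction.of_finsets (s : X → Finset Y) (hs : ∀ x, (s x).Nonempty)
    (hequiv : ∀ k : K, ∃ h : H, ∀ x y, y ∈ s (h • x) ↔ k⁻¹ • y ∈ s x)
    (hX : IsAmenableAction H X) : IsAmenableAction K Y := by
  refine hX.of_positive_map (averageMap s) (fun a ha x => ?_) ?_ fun k => ?_
  · rw [averageMap_apply]
    refine mul_nonneg (inv_nonneg.2 (by positivity)) (Finset.sum_nonneg fun y _ => ha y)
  · ext x
    -- Nonemptiness matters here: an average over the empty set would be `0`, not `1`.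
    have hx : ((s x).card : ℂ) ≠ 0 := by exact_mod_cast (hs x).card_pos.ne'
    rw [averageMap_apply]
    simp [lp.infty_coeFn_one, hx]
  · obtain ⟨h, hh⟩ := hequiv k
    refine ⟨h, fun a => ?_⟩
    ext x
    change ((s x).card : ℂ)⁻¹ * ∑ y ∈ s x, a (k⁻¹ • y) =
      ((s (h⁻¹ • x)).card : ℂ)⁻¹ * ∑ y ∈ s (h⁻¹ • x), a y
    -- The substitution `y ↦ k⁻¹ • y` carries `s x` bijectively onto `s (h⁻¹ • x)`, matching both
    -- the sums and their normalisations.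
    have hmem : ∀ y, y ∈ s x ↔ k⁻¹ • y ∈ s (h⁻¹ • x) := fun y => by
      simpa using hh (h⁻¹ • x) y
    have hcard : (s x).card = (s (h⁻¹ • x)).card :=
      Finset.card_equiv (MulAction.toPerm k⁻¹) hmem
    rw [hcard]
    exact congrArg _ (Finset.sum_equiv (MulAction.toPerm k⁻¹) hmem fun _ _ => rfl)

/-- Amenability transfers along an equivariant map. -/
theorem IsAmenableAction.of_map (f : X → Y)
    (hf : ∀ k : K, ∃ h : H, ∀ x, f (h • x) = k • f x)
    (hX : IsAmenableAction H X) : IsAmenableAction K Y := by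
  refine hX.of_finsets (fun x => {f x}) (fun x => Finset.singleton_nonempty _) fun k => ?_
  obtain ⟨h, hh⟩ := hf k
  exact ⟨h, fun x y => by rw [Finset.mem_singleton, Finset.mem_singleton, hh, inv_smul_eq_iff]⟩

/-- On an empty set `1 = 0` as functions, so no functional is unital. This supplies the point needed
to show that `H` is a proper subgroup. -/
theorem IsAmenableAction.nonempty (hX : IsAmenableAction H X) : Nonempty X := by
  obtain ⟨φ, hφ, -⟩ := hX
  by_contra hne
  rw [not_nonempty_iff] at hne
  have h : (1 : lp (fun _ : X => ℂ) ∞) = 0 := by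
    ext x
    exact isEmptyElim x
  have h1 := hφ.unital
  rw [h, map_zero] at h1
  exact zero_ne_one h1

end Transport

/-! ### Supports and point masses in restricted powers -/

section RestrictedPower

variable {H X Z : Type*} [Group H] [MulAction H X] [Group Z]

/-- The support of an element of the restricted power. -/
noncomputable def RestrictedPower.support (a : RestrictedPower X Z) : Finset X :=
  Set.Finite.toFinset (s := {x | a.1 x ≠ 1}) a.2

theorem RestrictedPower.mem_support {a : RestrictedPower X Z} {x : X} :
    x ∈ a.support ↔ a.1 x ≠ 1 :=
  Set.Finite.mem_toFinset _

theorem RestrictedPower.support_nonempty {a : RestrictedPower X Z} (ha : a ≠ 1) :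
    a.support.Nonempty := by
  by_contra h
  rw [Finset.not_nonempty_iff_eq_empty] at h
  refine ha (Subtype.ext (funext fun x => ?_))
  by_contra hx
  have : x ∈ a.support := RestrictedPower.mem_support.2 hx
  simp [h] at this

theorem RestrictedPower.mem_support_smul {h : H} {a : RestrictedPower X Z} {x : X} :
    x ∈ (h • a).support ↔ h⁻¹ • x ∈ a.support := by
  rw [RestrictedPower.mem_support, RestrictedPower.mem_support]
  rfl

open Classical in
/-- The function equal to `z` at `x` and trivial elsewhere. -/
noncomputable def pointMass (z : Z) (x : X) : RestrictedPower X Z :=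
  ⟨Pi.mulSingle (M := fun _ : X => Z) x z, (Set.finite_singleton x).subset fun y hy => by
    by_contra hne
    exact hy (Pi.mulSingle_eq_of_ne (M := fun _ : X => Z) hne z)⟩

theorem pointMass_ne_one {z : Z} (hz : z ≠ 1) (x : X) : pointMass z x ≠ 1 := by
  classical
  intro h
  have h1 : (pointMass z x).1 x = 1 := by rw [h]; rfl
  exact hz (by simpa [pointMass] using h1)

theorem smul_pointMass (h : H) (z : Z) (x : X) :
    h • pointMass z x = pointMass z (h • x) := by
  classical
  refine Subtype.ext (funext fun y => ?_)
  change Pi.mulSingle (M := fun _ : X => Z) x z (h⁻¹ • y) =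
    Pi.mulSingle (M := fun _ : X => Z) (h • x) z y
  simp only [Pi.mulSingle_apply, inv_smul_eq_iff]

/-- A restricted power element with finite Bernoulli orbit is supported on finite orbits. -/
theorem finite_orbit_of_mem_support {a : RestrictedPower X Z} {x : X} (hx : x ∈ a.support)
    (ha : (MulAction.orbit H a).Finite) : (MulAction.orbit H x).Finite := by
  -- The orbit of `x` lies in the union of the finite supports of the translates of `a`.
  refine (ha.biUnion fun b _ => b.support.finite_toSet).subset ?_
  rintro _ ⟨h, rfl⟩
  refine Set.mem_biUnion (MulAction.mem_orbit a h) (Finset.mem_coe.2 ?_)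
  change h • x ∈ _
  rw [RestrictedPower.mem_support_smul, inv_smul_smul]
  exact hx

theorem isAmenableAction_nontrivialElements_iff [Nontrivial Z] :
    IsAmenableAction H (NontrivialElements (RestrictedPower X Z)) ↔ IsAmenableAction H X := by
  constructor
  · refine IsAmenableAction.of_finsets (fun a => a.1.support)
      (fun a => RestrictedPower.support_nonempty a.2) fun k => ⟨k, fun a x => ?_⟩
    exact RestrictedPower.mem_support_smul
  · obtain ⟨z, hz⟩ := exists_ne (1 : Z)
    exact IsAmenableAction.of_map (fun x => ⟨pointMass z x, pointMass_ne_one hz x⟩) fun k =>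
      ⟨k, fun x => Subtype.ext (smul_pointMass k z x).symm⟩

end RestrictedPower

/-! ### Conjugation in the restricted wreath product -/

section Wreath

variable {H X Z : Type*} [Group H] [MulAction H X] [Group Z]

theorem mem_topGroup_iff {g : RestrictedWreath Z X H} : g ∈ topGroup Z X H ↔ g.left = 1 := by
  constructor
  · rintro ⟨h, rfl⟩
    exact SemidirectProduct.left_inr h
  · intro hg
    exact ⟨g.right, SemidirectProduct.ext hg.symm rfl⟩

/-- Since the right coordinate plays no role here, a finite `H`-conjugacy orbit of `g` projects onto
a finite Bernoulli orbit of `g.left`. -/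
theorem left_inr_conj (h : H) (g : RestrictedWreath Z X H) :
    (SemidirectProduct.inr h * g * (SemidirectProduct.inr h)⁻¹).left = h • g.left := by
  rw [← map_inv]
  simp

theorem inr_conj_inl (h : H) (a : RestrictedPower X Z) :
    (SemidirectProduct.inr h * SemidirectProduct.inl a * (SemidirectProduct.inr h)⁻¹ :
      RestrictedWreath Z X H) = SemidirectProduct.inl (h • a) := by
  rw [← map_inv]
  exact (SemidirectProduct.inl_aut h a).symm

theorem inl_pointMass_notMem_topGroup {z : Z} (hz : z ≠ 1) (x : X) :
    (SemidirectProduct.inl (pointMass z x) : RestrictedWreath Z X H) ∉ topGroup Z X H := by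
  rw [mem_topGroup_iff, SemidirectProduct.left_inl]
  exact pointMass_ne_one hz x

theorem isInnerAmenableRel_topGroup [Nontrivial Z] (hX : IsAmenableAction H X) :
    IsInnerAmenableRel (topGroup Z X H) := by
  obtain ⟨z, hz⟩ := exists_ne (1 : Z)
  obtain ⟨x⟩ := hX.nonempty
  refine ⟨fun htop => inl_pointMass_notMem_topGroup (H := H) hz x (htop ▸ Subgroup.mem_top _),
    hX.of_map (fun x => ⟨_, inl_pointMass_notMem_topGroup hz x⟩) ?_⟩
  rintro ⟨_, h, rfl⟩
  refine ⟨h, fun x => Subtype.ext ?_⟩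
  change SemidirectProduct.inl (pointMass z (h • x)) =
    SemidirectProduct.inr h * SemidirectProduct.inl (pointMass z x) * (SemidirectProduct.inr h)⁻¹
  rw [inr_conj_inl, smul_pointMass]

theorem conditionStar_topGroup_iff [Nontrivial Z] :
    ConditionStar (topGroup Z X H) ↔ ∀ x : X, (MulAction.orbit H x).Infinite := by
  constructor
  · intro hstar x hfin
    obtain ⟨z, hz⟩ := exists_ne (1 : Z)
    refine hstar _ (inl_pointMass_notMem_topGroup hz x)
      ((hfin.image fun y => SemidirectProduct.inl (pointMass z y)).subset ?_)
    rintro _ ⟨_, ⟨h, rfl⟩, rfl⟩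
    exact ⟨h • x, MulAction.mem_orbit x h, by rw [inr_conj_inl, smul_pointMass]⟩
  · intro horb g hg hfin
    rw [mem_topGroup_iff] at hg
    obtain ⟨x, hx⟩ := RestrictedPower.support_nonempty hg
    refine horb x (finite_orbit_of_mem_support hx
      ((hfin.image SemidirectProduct.left).subset ?_))
    rintro _ ⟨h, rfl⟩
    exact ⟨_, ⟨_, ⟨h, rfl⟩, rfl⟩, left_inr_conj h g⟩

theorem ConditionStar.not_isTriviallyInnerAmenableRel {G : Type*} [Group G] {K : Subgroup G}
    (hK : ConditionStar K) : ¬ IsTriviallyInnerAmenableRel K :=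
  fun ⟨g, hg, hfin⟩ => hK g hg hfin

end Wreath

end RelInner

open RelInner
theorem theoremB {H X Z : Type*} [Group H] [MulAction H X] [Group Z] [Nontrivial Z] :
    (IsAmenableAction H (NontrivialElements (RestrictedPower X Z)) ↔ IsAmenableAction H X) ∧
    (IsAmenableAction H X → IsInnerAmenableRel (topGroup Z X H)) ∧
    (Infinite X →
      (ConditionStar (topGroup Z X H) ↔ ∀ x : X, (MulAction.orbit H x).Infinite)) ∧
    (IsAmenableAction H X → (∀ x : X, (MulAction.orbit H x).Infinite) →
      IsNontriviallyInnerAmenableRel (topGroup Z X H)) :=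
  ⟨isAmenableAction_nontrivialElements_iff, isInnerAmenableRel_topGroup,
    fun _ => conditionStar_topGroup_iff,
    fun hX horb => ⟨isInnerAmenableRel_topGroup hX,
      (conditionStar_topGroup_iff.2 horb).not_isTriviallyInnerAmenableRel⟩⟩
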